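/- Let $D$ be an open set in $\mathbb C^n$, $n\ge 3$, which is not pseudoconvex; here an open subset $G$ of a finite-dimensional complex vector space is called pseudoconvex if there is a continuous plurisubharmonic function $u:G\to\mathbb R$ such that $\{z\in G: u(z)\le c\}$ is compact for every $c\in\mathbb R$ (in particular the empty set is pseudoconvex). All planes and hyperplanes below are complex affine subspaces, not necessarily through the origin, and for a $2$-dimensional complex plane $P$ the set $P\cap D$ is called pseudoconvex if it is pseudoconvex as an open subset of $P\cong\mathbb C^2$. Call $a\in\mathbb C^n$ exceptional with respect to $D$ if $P\cap D$ is pseudoconvex for every $2$-dimensional complex plane $P\ni a$. Let $S$ be the union of all $2$-dimensional complex planes whose intersection with $D$ is non-empty and not pseudoconvex. Then the set of exceptional points is $\mathbb C^n\setminus S$, and there exists a complex hyperplane $T\subset\mathbb C^n$ such that $\mathbb C^n\setminus S\subset T$. -/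

import Mathlib

open Module

/-- `u` is a (real-valued) continuous plurisubharmonic function on the set `D` of the complex
normed space `E`: it is continuous on `D`, and it satisfies the sub-mean value inequality on every
closed affine complex disc `{a + ζ b : |ζ| ≤ 1}` contained in `D`. -/
def IsContinuousPSH {E : Type*} [NormedAddCommGroup E] [NormedSpace ℂ E]
    (u : E → ℝ) (D : Set E) : Prop :=
  ContinuousOn u D ∧
    ∀ a b : E, (∀ ζ : ℂ, ‖ζ‖ ≤ 1 → a + ζ • b ∈ D) →
      u a ≤ Real.circleAverage (fun ζ : ℂ => u (a + ζ • b)) 0 1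

/-- `D` is pseudoconvex: it is open and carries a continuous plurisubharmonic exhaustion function.
(Neither connectedness nor boundedness is required; the empty set and the whole space are
pseudoconvex.) -/
def IsPseudoconvex {E : Type*} [NormedAddCommGroup E] [NormedSpace ℂ E] (D : Set E) : Prop :=
  IsOpen D ∧ ∃ u : E → ℝ, IsContinuousPSH u D ∧ ∀ c : ℝ, IsCompact {z | z ∈ D ∧ u z ≤ c}

/-- The intersection `P ∩ D` is pseudoconvex as a subset of the complex affine subspace `P`, where
`P` is identified with its direction, a complex vector space, by choosing an origin `p ∈ P`. -/
def IsPseudoconvexSlice {E : Type*} [NormedAddCommGroup E] [NormedSpace ℂ E]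
    (P : AffineSubspace ℂ E) (D : Set E) : Prop :=
  ∀ p ∈ P, IsPseudoconvex {v : P.direction | p + (v : E) ∈ D}

/-- A 2-dimensional complex (affine) plane. -/
def IsComplexPlane {n : ℕ} (P : AffineSubspace ℂ (EuclideanSpace ℂ (Fin n))) : Prop :=
  (P : Set (EuclideanSpace ℂ (Fin n))).Nonempty ∧ finrank ℂ P.direction = 2

/-- A complex (affine) hyperplane of `ℂⁿ`. -/
def IsComplexHyperplane {n : ℕ} (T : AffineSubspace ℂ (EuclideanSpace ℂ (Fin n))) : Prop :=
  (T : Set (EuclideanSpace ℂ (Fin n))).Nonempty ∧ finrank ℂ T.direction + 1 = n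

/-- `a` is exceptional with respect to `D`: every 2-dimensional complex plane through `a` meets `D`
in a pseudoconvex set. -/
def IsExceptional {n : ℕ} (D : Set (EuclideanSpace ℂ (Fin n)))
    (a : EuclideanSpace ℂ (Fin n)) : Prop :=
  ∀ P : AffineSubspace ℂ (EuclideanSpace ℂ (Fin n)),
    IsComplexPlane P → a ∈ P → IsPseudoconvexSlice P D

/-- The union of all 2-dimensional complex planes whose intersection with `D` is nonempty and not
pseudoconvex. -/
def nonPseudoconvexPlanesUnion {n : ℕ} (D : Set (EuclideanSpace ℂ (Fin n))) :
    Set (EuclideanSpace ℂ (Fin n)) :=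
  {a | ∃ P : AffineSubspace ℂ (EuclideanSpace ℂ (Fin n)), IsComplexPlane P ∧
    ((P : Set (EuclideanSpace ℂ (Fin n))) ∩ D).Nonempty ∧ ¬ IsPseudoconvexSlice P D ∧ a ∈ P}

/-!
The hyperplane `T` is the complex tangent hyperplane at a boundary point of `D` where
pseudoconvexity fails.

If `D ≠ ℂⁿ` is not pseudoconvex, then `-log dist(·, Dᶜ)` violates the sub-mean value inequality on
some affine disc (`isPseudoconvex_of_neg_log_infDist`). Approximating by real parts of entire
functions on the boundary circle and taking the maximum of a difference, one finds a complex line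
along which `-log dist(·, Dᶜ)` is touched from above by `Re g - ε|l|²` with `g` entire. In terms
of `f = exp(g(0) - g)` this says that `D` contains balls centred on the line with radii at least
`‖v‖ |f(l)| √(1 + ε|l|²)`, and the one for `l = 0` has a point `b ∉ D` on its boundary, where `v`
is the vector from the centre to `b` (`exists_touching_family_of_balls`). To first order the disc
`b + l w + (f(l) - 1) v` is tangent to `vᗮ` (`inner_add_deriv_smul_eq_zero`), and for
small `l ≠ 0` it lies in `D`.

Put `T = b + vᗮ` and let `c ∉ T`. The plane through `b` and `c` that contains the tangent vector
`w + f'(0) v` is transverse to `vᗮ`. Moving the disc into this plane along `vᗮ` changes it by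
`o(|l|)` orthogonally to `v`, which the factor `1 + ε|l|²` absorbs. So the plane contains
holomorphic discs in `D` that converge to a disc with boundary in `D` and centre `b ∉ D`, and the
continuity principle shows that the section is not pseudoconvex (`not_isPseudoconvex_section`).
Hence `c` is not exceptional.

Plurisubharmonicity is only given on affine discs, whereas the discs above are graphs of entire
functions. The maximum principle on such graphs, `IsContinuousPSH.le_of_graph`, is proved without
smoothing, by comparison with a test function whose complex Hessian is explicit.
-/

/-! ### Circle averages and entire functions -/

open Real Metric Set in
/-- Mean value property of the real part of an entire function. -/
theorem circleAverage_re_of_differentiable {k : ℂ → ℂ} (hk : Differentiable ℂ k) :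
    circleAverage (fun ζ => (k ζ).re) 0 1 = (k 0).re := by
  have h := Complex.reCLM.circleAverage_comp_comm (f := k) (c := 0) (R := 1)
    hk.continuous.continuousOn.circleIntegrable'
  have h2 : circleAverage k 0 1 = k 0 := (hk.diffContOnCl).circleAverage
  rw [h2] at h
  exact h

open Real Metric Set in
/-- Comparison of a circle average with a constant plus the real part of an entire function. -/
theorem circleAverage_le_add_re {v : ℂ → ℝ} {k : ℂ → ℂ} {A : ℝ}
    (hv : ContinuousOn v (sphere 0 1)) (hk : Differentiable ℂ k)
    (h : ∀ ζ : ℂ, ‖ζ‖ = 1 → v ζ ≤ A + (k ζ).re) :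
    circleAverage v 0 1 ≤ A + (k 0).re := by
  have hkc : CircleIntegrable (fun ζ => (k ζ).re) 0 1 :=
    (Complex.continuous_re.comp hk.continuous).continuousOn.circleIntegrable'
  have hc : CircleIntegrable (fun _ : ℂ => A) 0 1 := continuousOn_const.circleIntegrable'
  calc circleAverage v 0 1 ≤ circleAverage (fun ζ => A + (k ζ).re) 0 1 := by
        refine circleAverage_mono ?_ ?_ ?_
        · exact ContinuousOn.circleIntegrable' (by simpa using hv)
        · exact hc.add hkc
        · intro ζ hζ
          exact h ζ (by simpa using hζ)
    _ = A + (k 0).re := by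
        rw [circleAverage_fun_add hc hkc, circleAverage_const, circleAverage_re_of_differentiable hk]

open Real Metric Set in
/-- A continuous function on the unit circle is a uniform limit of real parts of entire functions,
because every trigonometric polynomial has the same real part as a polynomial in `ζ`. -/
theorem exists_entire_re_approx {h : ℂ → ℝ} (hh : ContinuousOn h (sphere 0 1)) {ε : ℝ}
    (hε : 0 < ε) :
    ∃ g : ℂ → ℂ, Differentiable ℂ g ∧ ∀ ζ : ℂ, ‖ζ‖ = 1 → |(g ζ).re - h ζ| < ε := by
  let F : C(AddCircle (1 : ℝ), ℂ) :=
    ⟨fun x => (h (AddCircle.toCircle x : ℂ) : ℂ), Complex.continuous_ofReal.comp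
      (hh.comp_continuous (by fun_prop) (fun x => mem_sphere_zero_iff_norm.2 (Circle.norm_coe _)))⟩
  have hF : F ∈ (Submodule.span ℂ (range <| @fourier (1 : ℝ))).topologicalClosure := by
    rw [span_fourier_closure_eq_top]; trivial
  obtain ⟨p, hp, hpF⟩ := Metric.mem_closure_iff.1 hF ε hε
  have key : ∀ c : ℂ, ∃ g : ℂ → ℂ, Differentiable ℂ g ∧
      ∀ x : AddCircle (1 : ℝ), (g (AddCircle.toCircle x)).re = (c * p x).re := by
    refine Submodule.span_induction (p := fun (p : C(AddCircle (1 : ℝ), ℂ)) _ =>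
      ∀ c : ℂ, ∃ g : ℂ → ℂ, Differentiable ℂ g ∧
      ∀ x : AddCircle (1 : ℝ), (g (AddCircle.toCircle x)).re = (c * p x).re) ?_ ?_ ?_ ?_ hp
    · rintro _ ⟨n, rfl⟩ c
      obtain ⟨m, rfl | rfl⟩ := n.eq_nat_or_neg
      · refine ⟨fun ζ => c * ζ ^ m, by fun_prop, fun x => ?_⟩
        simp [fourier_apply, AddCircle.toCircle_nsmul]
      · refine ⟨fun ζ => (starRingEnd ℂ) c * ζ ^ m, by fun_prop, fun x => ?_⟩
        rw [← Complex.conj_re]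
        simp [fourier_apply, AddCircle.toCircle_nsmul, AddCircle.toCircle_neg,
          ← Circle.coe_inv_eq_conj]
    · exact fun c => ⟨0, differentiable_const 0, fun x => by simp⟩
    · intro p q _ _ hp hq c
      obtain ⟨g, hg, hgp⟩ := hp c
      obtain ⟨k, hk, hkq⟩ := hq c
      refine ⟨fun ζ => g ζ + k ζ, hg.add hk, fun x => ?_⟩
      rw [Complex.add_re, hgp, hkq, ContinuousMap.add_apply, mul_add, Complex.add_re]
    · intro a p _ hp c
      obtain ⟨g, hg, hgp⟩ := hp (c * a)
      refine ⟨g, hg, fun x => ?_⟩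
      rw [hgp, ContinuousMap.smul_apply, smul_eq_mul, mul_assoc]
  obtain ⟨g, hg, hgp⟩ := key 1
  refine ⟨g, hg, fun ζ hζ => ?_⟩
  obtain ⟨x, hx⟩ := (AddCircle.homeomorphCircle (one_ne_zero (α := ℝ))).surjective
    (⟨ζ, mem_sphere_zero_iff_norm.2 hζ⟩ : Circle)
  have hx' : (AddCircle.toCircle x : ℂ) = ζ := by
    rw [AddCircle.homeomorphCircle_apply] at hx
    rw [hx]
  have h1 := hgp x
  rw [hx', one_mul] at h1
  rw [h1]
  have h2 : ‖F x - p x‖ < ε := by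
    rw [← dist_eq_norm]; exact (ContinuousMap.dist_apply_le_dist x).trans_lt hpF
  have h3 : F x = (h ζ : ℂ) := by simp [F, hx']
  rw [h3] at h2
  calc |(p x).re - h ζ| = |((h ζ : ℂ) - p x).re| := by
        rw [abs_sub_comm]; simp
    _ ≤ ‖(h ζ : ℂ) - p x‖ := Complex.abs_re_le_norm _
    _ < ε := h2

/-! ### The maximum principle on holomorphic graphs -/

open Real Metric Set Topology in
/-- **Maximum principle on a holomorphic graph.** A function that satisfies the sub-mean value
inequality on affine discs only still obeys the maximum principle on the graph of an entire
function `s`: otherwise `u + η|λ|² - A|τ - s(λ)|²`, for large `A`, has a local maximum near the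
graph, whereas its complex Hessian is at least `η` in the direction `(1, s')` tangent to the level
sets of `τ - s(λ)`. -/
theorem IsContinuousPSH.le_of_graph {U : Set (ℂ × ℂ)} {u : ℂ × ℂ → ℝ} (hU : IsOpen U)
    (hu : IsContinuousPSH u U) {s : ℂ → ℂ} (hs : Differentiable ℂ s) {r M : ℝ} (hr : 0 < r)
    (hsU : ∀ l : ℂ, ‖l‖ ≤ r → (l, s l) ∈ U) (hM : ∀ l : ℂ, ‖l‖ = r → u (l, s l) ≤ M) :
    u (0, s 0) ≤ M := by
  by_contra! hlt
  obtain ⟨μ, hμ, hμM⟩ : ∃ μ > 0, u (0, s 0) = M + 2 * μ :=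
    ⟨(u (0, s 0) - M) / 2, by linarith, by ring⟩
  -- Shear coordinates in which the graph becomes `τ = 0`.
  set Ψ : ℂ × ℂ → ℂ × ℂ := fun p => (p.1, s p.1 + p.2) with hΨ
  have hΨc : Continuous Ψ := by
    have := hs.continuous
    fun_prop
  have hVo : IsOpen (Ψ ⁻¹' U) := hU.preimage hΨc
  have huc : ContinuousOn (u ∘ Ψ) (Ψ ⁻¹' U) := hu.1.comp hΨc.continuousOn (fun _ h => h)
  have hBo : IsOpen (Ψ ⁻¹' U ∩ (u ∘ Ψ) ⁻¹' Iio (M + μ)) := huc.isOpen_inter_preimage hVo isOpen_Iio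
  obtain ⟨U₁, V₁, -, hV₁, hK₁, h0₁, hsub₁⟩ := generalized_tube_lemma
    (isCompact_closedBall (0 : ℂ) r) (isCompact_singleton (x := (0 : ℂ))) hVo (by
      rintro ⟨l, t⟩ ⟨hl, ht⟩
      simp only [mem_singleton_iff] at ht
      subst ht
      simpa [Ψ] using hsU l (by simpa using hl))
  obtain ⟨U₂, V₂, -, hV₂, hK₂, h0₂, hsub₂⟩ := generalized_tube_lemma
    (isCompact_sphere (0 : ℂ) r) (isCompact_singleton (x := (0 : ℂ))) hBo (by
      rintro ⟨l, t⟩ ⟨hl, ht⟩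
      simp only [mem_singleton_iff] at ht
      subst ht
      have hl' : ‖l‖ = r := by simpa using hl
      refine ⟨by simpa [Ψ] using hsU l hl'.le, ?_⟩
      have := hM l hl'
      simp only [Ψ, mem_preimage, Function.comp, add_zero, mem_Iio]
      linarith)
  obtain ⟨δ, hδ, hδV⟩ : ∃ δ > 0, closedBall (0 : ℂ) δ ⊆ V₁ ∩ V₂ :=
    Metric.nhds_basis_closedBall.mem_iff.1 ((hV₁.inter hV₂).mem_nhds ⟨h0₁ rfl, h0₂ rfl⟩)
  have hKV : closedBall (0 : ℂ) r ×ˢ closedBall (0 : ℂ) δ ⊆ Ψ ⁻¹' U := fun p hp =>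
    hsub₁ ⟨hK₁ hp.1, (hδV hp.2).1⟩
  have hKc : IsCompact (closedBall (0 : ℂ) r ×ˢ closedBall (0 : ℂ) δ) :=
    (isCompact_closedBall _ _).prod (isCompact_closedBall _ _)
  obtain ⟨B, hB⟩ := (hKc.image_of_continuousOn (huc.mono hKV)).bddAbove
  set η : ℝ := μ / r ^ 2 with hη
  have hη0 : 0 < η := by positivity
  have hηr : η * r ^ 2 = μ := by rw [hη]; field_simp
  set A : ℝ := (|B| + |M| + 1) / δ ^ 2 with hA
  have hA0 : 0 < A := by positivity
  have hAδ : A * δ ^ 2 = |B| + |M| + 1 := by rw [hA]; field_simp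
  set Φ : ℂ × ℂ → ℝ := fun p => u (Ψ p) + η * ‖p.1‖ ^ 2 - A * ‖p.2‖ ^ 2 with hΦ
  have hΦc : ContinuousOn Φ (closedBall (0 : ℂ) r ×ˢ closedBall (0 : ℂ) δ) := by
    refine ((huc.mono hKV).add ?_).sub ?_ <;> fun_prop
  obtain ⟨⟨a, t⟩, hat, hmax⟩ := hKc.exists_isMaxOn
    ⟨(0, 0), by simp [hr.le, hδ.le]⟩ hΦc
  have hge : M + 2 * μ ≤ Φ (a, t) := by
    have := hmax (show ((0, 0) : ℂ × ℂ) ∈ closedBall (0 : ℂ) r ×ˢ closedBall (0 : ℂ) δ by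
      simp [hr.le, hδ.le])
    simpa [hΦ, Ψ, hμM] using this
  have hat' := hat
  simp only [mem_prod, mem_closedBall, dist_zero_right] at hat'
  -- The maximum lies neither over `‖λ‖ = r` nor on `‖τ‖ = δ`.
  have ha : ‖a‖ < r := by
    refine lt_of_le_of_ne hat'.1 fun h => ?_
    have h1 : u (Ψ (a, t)) < M + μ :=
      (hsub₂ ⟨hK₂ (by simpa using h), (hδV hat.2).2⟩ :
        ((a, t) : ℂ × ℂ) ∈ Ψ ⁻¹' U ∩ (u ∘ Ψ) ⁻¹' Iio (M + μ)).2
    have h2 : 0 ≤ A * ‖t‖ ^ 2 := by positivity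
    simp only [hΦ, h] at hge
    linarith
  have ht : ‖t‖ < δ := by
    refine lt_of_le_of_ne hat'.2 fun h => ?_
    have h1 : u (Ψ (a, t)) ≤ B := hB ⟨_, hat, rfl⟩
    have h2 : η * ‖a‖ ^ 2 ≤ η * r ^ 2 := by gcongr
    simp only [hΦ, h] at hge
    linarith [le_abs_self B, neg_abs_le M]
  set R : ℂ → ℂ := fun x => s (a + x) - s a - x * deriv s a with hR
  have hRd : Differentiable ℂ R := by
    have : Differentiable ℂ fun x => s (a + x) := hs.comp (by fun_prop)
    fun_prop
  have hR0 : R 0 = 0 := by simp [hR]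
  -- `R` vanishes to higher than first order, so `A‖R‖²` is absorbed by `η‖x‖²`.
  have hRo : ∀ᶠ x in 𝓝 (0 : ℂ), A * ‖R x‖ ^ 2 ≤ η / 2 * ‖x‖ ^ 2 := by
    have h := (hs a).hasDerivAt.isLittleO
    have h' := (h.comp_tendsto (k := fun x : ℂ => a + x) (l' := 𝓝 0)
      (Continuous.tendsto' (by fun_prop) 0 a (by simp))).def (c := √(η / (2 * A))) (by positivity)
    filter_upwards [h'] with x hx
    have hx' : ‖R x‖ ≤ √(η / (2 * A)) * ‖x‖ := by simpa [hR] using hx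
    calc A * ‖R x‖ ^ 2 ≤ A * (√(η / (2 * A)) * ‖x‖) ^ 2 := by gcongr
      _ = η / 2 * ‖x‖ ^ 2 := by
        rw [mul_pow, Real.sq_sqrt (by positivity)]; field_simp
  have hnear : ∀ᶠ x in 𝓝 (0 : ℂ), ((a + x, t - R x) : ℂ × ℂ) ∈
      closedBall (0 : ℂ) r ×ˢ closedBall (0 : ℂ) δ := by
    have hc : Continuous fun x : ℂ => ((a + x, t - R x) : ℂ × ℂ) := by
      have := hRd.continuous
      fun_prop
    have hm : ball (0 : ℂ) r ×ˢ ball (0 : ℂ) δ ∈ 𝓝 ((a + 0, t - R 0) : ℂ × ℂ) := by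
      refine (isOpen_ball.prod isOpen_ball).mem_nhds ?_
      simp [hR0, ha, ht]
    filter_upwards [hc.continuousAt.preimage_mem_nhds hm] with x hx
    exact prod_mono ball_subset_closedBall ball_subset_closedBall hx
  obtain ⟨ρ, hρ, hρsub⟩ := Metric.nhds_basis_closedBall.eventually_iff.1 (hRo.and hnear)
  have hpt : ∀ x : ℂ, (Ψ (a, t) + x • ((1, deriv s a) : ℂ × ℂ)) = Ψ (a + x, t - R x) := by
    intro x
    ext
    · simp [Ψ]
    · simp only [Ψ, hR, Prod.snd_add, Prod.smul_snd, smul_eq_mul]; ring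
  set b : ℂ × ℂ := (ρ : ℂ) • (1, deriv s a) with hb
  have hpt' : ∀ ζ : ℂ, Ψ (a, t) + ζ • b = Ψ (a + ζ * ρ, t - R (ζ * ρ)) := by
    intro ζ; rw [← hpt, hb, smul_smul]
  have hmem : ∀ ζ : ℂ, ‖ζ‖ ≤ 1 → ζ * ρ ∈ closedBall (0 : ℂ) ρ := by
    intro ζ hζ
    simp only [mem_closedBall, dist_zero_right, norm_mul, Complex.norm_real, Real.norm_eq_abs,
      abs_of_pos hρ]
    nlinarith
  have hdisc : ∀ ζ : ℂ, ‖ζ‖ ≤ 1 → Ψ (a, t) + ζ • b ∈ U := by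
    intro ζ hζ
    rw [hpt']
    exact hKV (hρsub (hmem ζ hζ)).2
  have hsub := hu.2 (Ψ (a, t)) b hdisc
  set k : ℂ → ℂ := fun ζ => -(2 * η) * ((starRingEnd ℂ) a * (ζ * ρ))
    - 2 * A * ((starRingEnd ℂ) t * R (ζ * ρ)) with hk
  have hkd : Differentiable ℂ k := by
    have : Differentiable ℂ fun ζ : ℂ => R (ζ * ρ) := hRd.comp (by fun_prop)
    fun_prop
  have hle := circleAverage_le_add_re (v := fun ζ => u (Ψ (a, t) + ζ • b))
    (A := u (Ψ (a, t)) - η / 2 * ρ ^ 2) (k := k) ?_ hkd ?_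
  · have hk0 : k 0 = 0 := by simp [hk, hR0]
    rw [hk0, Complex.zero_re] at hle
    have : 0 < η / 2 * ρ ^ 2 := by positivity
    linarith
  · refine hu.1.comp (by fun_prop) fun ζ hζ => hdisc ζ ?_
    simpa using hζ.le
  · intro ζ hζ
    have hx := hρsub (hmem ζ hζ.le)
    have hxn : ‖ζ * (ρ : ℂ)‖ = ρ := by simp [hζ, abs_of_pos hρ]
    rw [hpt']
    have hkre : (k ζ).re = -(2 * η) * ((starRingEnd ℂ) a * (ζ * ρ)).re
        - 2 * A * ((starRingEnd ℂ) t * R (ζ * ρ)).re := by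
      have h1 : (-(2 * η) : ℂ) = ((-(2 * η) : ℝ) : ℂ) := by push_cast; ring
      have h2 : (2 * A : ℂ) = ((2 * A : ℝ) : ℂ) := by push_cast; ring
      rw [hk]
      simp only [Complex.sub_re]
      rw [h1, h2, Complex.re_ofReal_mul, Complex.re_ofReal_mul]
    have h1 := hmax hx.2
    have h2 := hx.1
    generalize ζ * (ρ : ℂ) = x at *
    simp only [hΦ, mem_ofPred_eq] at h1
    have h3 : ‖a + x‖ ^ 2 = ‖a‖ ^ 2 + 2 * ((starRingEnd ℂ) a * x).re + ‖x‖ ^ 2 := by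
      simp only [Complex.sq_norm, Complex.normSq_apply, Complex.mul_re, Complex.conj_re,
        Complex.conj_im, Complex.add_re, Complex.add_im]; ring
    have h4 : ‖t - R x‖ ^ 2 = ‖t‖ ^ 2 - 2 * ((starRingEnd ℂ) t * R x).re + ‖R x‖ ^ 2 := by
      simp only [Complex.sq_norm, Complex.normSq_apply, Complex.mul_re, Complex.conj_re,
        Complex.conj_im, Complex.sub_re, Complex.sub_im]; ring
    rw [h3, h4, hxn] at h1
    rw [hxn] at h2
    rw [hkre]
    linarith

/-! ### The distance to the complement -/

open Real Metric Set Topology in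
/-- `‖z‖²` is plurisubharmonic: its mean over the circle `a + ζ b` is `‖a‖² + ‖b‖²`. -/
theorem norm_sq_le_circleAverage {E : Type*} [NormedAddCommGroup E] [InnerProductSpace ℂ E]
    (a b : E) : ‖a‖ ^ 2 ≤ circleAverage (fun ζ : ℂ => ‖a + ζ • b‖ ^ 2) 0 1 := by
  have h := circleAverage_le_add_re (v := fun ζ : ℂ => -‖a + ζ • b‖ ^ 2)
    (k := fun ζ => -2 * (inner ℂ a b * ζ)) (A := -‖a‖ ^ 2) (by fun_prop) (by fun_prop) (by
      intro ζ _
      have h1 : ‖a + ζ • b‖ ^ 2 = ‖a‖ ^ 2 + 2 * (inner ℂ a b * ζ).re + ‖ζ • b‖ ^ 2 := by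
        rw [@norm_add_sq ℂ, inner_smul_right, mul_comm ζ]; rfl
      have h2 : (-2 * (inner ℂ a b * ζ)).re = -2 * (inner ℂ a b * ζ).re := by
        rw [show (-2 : ℂ) = ((-2 : ℝ) : ℂ) by norm_num, Complex.re_ofReal_mul]
      rw [h1, h2]
      nlinarith [sq_nonneg ‖ζ • b‖])
  have h2 : circleAverage (fun ζ : ℂ => -‖a + ζ • b‖ ^ 2) 0 1
      = - circleAverage (fun ζ : ℂ => ‖a + ζ • b‖ ^ 2) 0 1 := by
    simp [circleAverage, intervalIntegral.integral_neg]
  rw [h2] at h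
  simp only [mul_zero, Complex.zero_re, add_zero] at h
  linarith

open Real Metric Set Topology in
/-- The maximum of two functions with the sub-mean value property at `a` has that property. -/
theorem max_le_circleAverage {v w : ℂ → ℝ} {x y : ℝ} (hv : ContinuousOn v (sphere 0 1))
    (hw : ContinuousOn w (sphere 0 1)) (hx : x ≤ circleAverage v 0 1)
    (hy : y ≤ circleAverage w 0 1) :
    max x y ≤ circleAverage (fun ζ => max (v ζ) (w ζ)) 0 1 := by
  rw [← abs_one (α := ℝ)] at hv hw
  have hm : CircleIntegrable (fun ζ => max (v ζ) (w ζ)) 0 1 := (hv.sup hw).circleIntegrable'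
  exact max_le
    (hx.trans (circleAverage_mono hv.circleIntegrable' hm fun _ _ => le_max_left _ _))
    (hy.trans (circleAverage_mono hw.circleIntegrable' hm fun _ _ => le_max_right _ _))

open Real Metric Set Topology in
/-- If `-log dist(·, Dᶜ)` satisfies the sub-mean value inequality on all affine discs in `D`, then
`max ‖z‖² (-log dist(z, Dᶜ))` is an exhaustion function. The whole space is excluded because there
the distance to the empty complement is the junk value `0`. -/
theorem isPseudoconvex_of_neg_log_infDist {E : Type*} [NormedAddCommGroup E]
    [InnerProductSpace ℂ E] [ProperSpace E] {D : Set E} (hD : IsOpen D) (hne : Dᶜ.Nonempty)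
    (h : ∀ a b : E, (∀ ζ : ℂ, ‖ζ‖ ≤ 1 → a + ζ • b ∈ D) →
      -log (infDist a Dᶜ) ≤ circleAverage (fun ζ : ℂ => -log (infDist (a + ζ • b) Dᶜ)) 0 1) :
    IsPseudoconvex D := by
  have hpos : ∀ z, z ∈ D ↔ 0 < infDist z Dᶜ := fun z => by
    rw [← hD.isClosed_compl.notMem_iff_infDist_pos hne, notMem_compl_iff]
  have hlog : ContinuousOn (fun z => -log (infDist z Dᶜ)) D :=
    ((continuous_infDist_pt _).continuousOn.log fun z hz => ((hpos z).1 hz).ne').neg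
  refine ⟨hD, fun z => max (‖z‖ ^ 2) (-log (infDist z Dᶜ)), ⟨?_, ?_⟩, fun c => ?_⟩
  · exact ContinuousOn.sup (by fun_prop) hlog
  · intro a b hab
    refine max_le_circleAverage (by fun_prop) ?_ (norm_sq_le_circleAverage a b) (h a b hab)
    exact hlog.comp (by fun_prop) fun ζ hζ => hab ζ (by simpa using hζ.le)
  · have heq : {z | z ∈ D ∧ max (‖z‖ ^ 2) (-log (infDist z Dᶜ)) ≤ c} =
        {z | ‖z‖ ^ 2 ≤ c} ∩ {z | exp (-c) ≤ infDist z Dᶜ} := by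
      ext z
      constructor
      · rintro ⟨hz, hc⟩
        refine ⟨(le_max_left _ _).trans hc, ?_⟩
        exact (le_log_iff_exp_le ((hpos z).1 hz)).1 (by linarith [(le_max_right _ _).trans hc])
      · rintro ⟨h1, h2⟩
        have hz : 0 < infDist z Dᶜ := (exp_pos _).trans_le h2
        exact ⟨(hpos z).2 hz, max_le h1 (by linarith [(le_log_iff_exp_le hz).2 h2])⟩
    rw [heq]
    refine IsCompact.inter_right ?_ (isClosed_le continuous_const (continuous_infDist_pt _))
    refine (isCompact_closedBall (0 : E) (√c)).of_isClosed_subset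
      (isClosed_le (by fun_prop) continuous_const) fun z hz => ?_
    simpa using Real.le_sqrt_of_sq_le hz

theorem isPseudoconvex_univ {E : Type*} [NormedAddCommGroup E]
    [InnerProductSpace ℂ E] [ProperSpace E] : IsPseudoconvex (Set.univ : Set E) := by
  refine ⟨isOpen_univ, fun z => ‖z‖ ^ 2, ⟨by fun_prop, fun a b _ => norm_sq_le_circleAverage a b⟩,
    fun c => ?_⟩
  refine (isCompact_closedBall (0 : E) (√c)).of_isClosed_subset ?_ fun z hz => ?_
  · simpa using isClosed_le (by fun_prop : Continuous fun z : E => ‖z‖ ^ 2) continuous_const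
  · simpa using Real.le_sqrt_of_sq_le hz.2

open Real Metric Set Topology in
/-- If the sub-mean value inequality at the centre fails for a continuous function `h` on the unit
disc, then `h` is touched from above at some interior point `z` by the real part of an entire
function minus a positive multiple of `|ζ - z|²`. -/
theorem exists_touching_re_sub_sq {h : ℂ → ℝ} (hh : ContinuousOn h (closedBall 0 1))
    (hlt : circleAverage h 0 1 < h 0) :
    ∃ z : ℂ, ∃ g : ℂ → ℂ, ∃ ε > 0, ∃ ρ > 0, Differentiable ℂ g ∧ (g 0).re = h z ∧
      ∀ l : ℂ, ‖l‖ ≤ ρ → ‖z + l‖ ≤ 1 ∧ h (z + l) ≤ (g l).re - ε * ‖l‖ ^ 2 := by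
  obtain ⟨ε, hε, hεh⟩ : ∃ ε > 0, h 0 = circleAverage h 0 1 + 4 * ε :=
    ⟨(h 0 - circleAverage h 0 1) / 4, by linarith, by ring⟩
  have hs : ContinuousOn h (sphere 0 1) := hh.mono sphere_subset_closedBall
  obtain ⟨g, hg, hgh⟩ := exists_entire_re_approx hs hε
  have hg0 : (g 0).re ≤ circleAverage h 0 1 + ε := by
    have h1 := circleAverage_le_add_re (v := fun ζ => -h ζ) (k := fun ζ => -g ζ) (A := ε) hs.neg
      hg.neg (by
        intro ζ hζ
        have := abs_lt.1 (hgh ζ hζ)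
        simp only [Complex.neg_re]
        linarith)
    have h2 : circleAverage (fun ζ => -h ζ) 0 1 = -circleAverage h 0 1 := by
      simp [circleAverage, intervalIntegral.integral_neg]
    rw [h2, Complex.neg_re] at h1
    linarith
  obtain ⟨z, hz, hmax⟩ := (isCompact_closedBall (0 : ℂ) 1).exists_isMaxOn
    ⟨0, by simp⟩ (f := fun ζ => h ζ - (g ζ).re + ε * ‖ζ‖ ^ 2) (by
      have := hg.continuous
      refine (hh.sub ?_).add ?_ <;> fun_prop)
  have hz' : ‖z‖ < 1 := by
    refine lt_of_le_of_ne (by simpa using hz) fun hz1 => ?_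
    have h0 := hmax (show (0 : ℂ) ∈ closedBall 0 1 by simp)
    simp only [mem_ofPred_eq, hz1, norm_zero] at h0
    have := abs_lt.1 (hgh z hz1)
    linarith
  refine ⟨z, fun l => g (z + l) - g z - 2 * ε * ((starRingEnd ℂ) z * l) + h z, ε, hε,
    1 - ‖z‖, by linarith, ?_, by simp, fun l hl => ?_⟩
  · have : Differentiable ℂ fun l => g (z + l) := hg.comp (by fun_prop)
    fun_prop
  · have hzl : ‖z + l‖ ≤ 1 := (norm_add_le _ _).trans (by linarith)
    refine ⟨hzl, ?_⟩
    have h1 := hmax (show z + l ∈ closedBall (0 : ℂ) 1 by simpa using hzl)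
    have h3 : ‖z + l‖ ^ 2 = ‖z‖ ^ 2 + 2 * ((starRingEnd ℂ) z * l).re + ‖l‖ ^ 2 := by
      simp only [Complex.sq_norm, Complex.normSq_apply, Complex.mul_re, Complex.conj_re,
        Complex.conj_im, Complex.add_re, Complex.add_im]; ring
    simp only [mem_ofPred_eq] at h1
    rw [h3] at h1
    simp only [Complex.add_re, Complex.sub_re, Complex.ofReal_re]
    rw [show (2 * ε : ℂ) = ((2 * ε : ℝ) : ℂ) by push_cast; ring, Complex.re_ofReal_mul]
    linarith

/-! ### Touching balls at a boundary point -/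

open Real Metric Set Topology in
/-- Local form of the failure of pseudoconvexity: there is a point `b ∉ D` together with balls
around the points `b - v + l w` of a complex line, contained in `D`, whose radii are
`‖v‖ |f(l)| √(1 + ε|l|²)` with `f` holomorphic and `f 0 = 1`. The ball for `l = 0` touches `Dᶜ`
at `b`; the factor `1 + ε|l|²` expresses that along the line `-log dist(·, Dᶜ)` is touched from above
by a harmonic function minus a multiple of `|l|²`. -/
theorem exists_touching_family_of_balls {E : Type*} [NormedAddCommGroup E]
    [InnerProductSpace ℂ E] [ProperSpace E] {D : Set E} (hD : IsOpen D)
    (hDpc : ¬ IsPseudoconvex D) :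
    ∃ b v w : E, ∃ f : ℂ → ℂ, ∃ ε > 0, ∃ ρ > 0, b ∉ D ∧ v ≠ 0 ∧ Differentiable ℂ f ∧ f 0 = 1 ∧
      ∀ (l : ℂ) (x : E), ‖l‖ ≤ ρ →
        ‖x - (b - v) - l • w‖ ^ 2 < ‖v‖ ^ 2 * ‖f l‖ ^ 2 * (1 + ε * ‖l‖ ^ 2) → x ∈ D := by
  have hne : Dᶜ.Nonempty := by
    rw [nonempty_compl]
    rintro rfl
    exact hDpc isPseudoconvex_univ
  have hpos : ∀ z, z ∈ D ↔ 0 < infDist z Dᶜ := fun z => by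
    rw [← hD.isClosed_compl.notMem_iff_infDist_pos hne, notMem_compl_iff]
  obtain ⟨a, w, hdisc, hlt⟩ : ∃ a w : E, (∀ ζ : ℂ, ‖ζ‖ ≤ 1 → a + ζ • w ∈ D) ∧
      circleAverage (fun ζ : ℂ => -log (infDist (a + ζ • w) Dᶜ)) 0 1 < -log (infDist a Dᶜ) := by
    by_contra! h
    exact hDpc (isPseudoconvex_of_neg_log_infDist hD hne h)
  have hc : ContinuousOn (fun ζ : ℂ => -log (infDist (a + ζ • w) Dᶜ)) (closedBall 0 1) := by
    refine (ContinuousOn.log ?_ fun ζ hζ => ((hpos _).1 (hdisc ζ (by simpa using hζ))).ne').neg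
    exact ((continuous_infDist_pt _).comp (by fun_prop)).continuousOn
  obtain ⟨z, g, ε, hε, ρ, hρ, hg, hg0, htouch⟩ := exists_touching_re_sub_sq hc (by simpa using hlt)
  obtain ⟨b, hb, hbd⟩ := hD.isClosed_compl.exists_infDist_eq_dist hne (a + z • w)
  have hz : 0 < infDist (a + z • w) Dᶜ :=
    (hpos _).1 (hdisc z (by simpa using (htouch 0 (by simpa using hρ.le)).1))
  have hvn : ‖b - (a + z • w)‖ = exp (-(g 0).re) := by
    rw [hg0, neg_neg, exp_log hz, hbd, dist_comm, dist_eq_norm]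
  refine ⟨b, b - (a + z • w), w, fun l => Complex.exp (g 0 - g l), ε, hε, ρ, hρ, hb, ?_, ?_,
    by simp, fun l x hl hx => ?_⟩
  · rw [← norm_pos_iff, hvn]; exact exp_pos _
  · fun_prop
  · obtain ⟨hzl, hle⟩ := htouch l hl
    have hδ : 0 < infDist (a + (z + l) • w) Dᶜ := (hpos _).1 (hdisc _ hzl)
    have h1 : exp (-(g l).re + ε * ‖l‖ ^ 2) ≤ infDist (a + (z + l) • w) Dᶜ := by
      rw [← le_log_iff_exp_le hδ]; linarith
    have h2 : ‖b - (a + z • w)‖ ^ 2 * ‖Complex.exp (g 0 - g l)‖ ^ 2 * (1 + ε * ‖l‖ ^ 2) ≤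
        exp (-(g l).re + ε * ‖l‖ ^ 2) ^ 2 := by
      rw [hvn, Complex.norm_exp, ← mul_pow, ← exp_add, exp_add _ (ε * ‖l‖ ^ 2), mul_pow]
      have h3 : -(g 0).re + (g 0 - g l).re = -(g l).re := by rw [Complex.sub_re]; ring
      rw [h3]
      gcongr
      have := add_one_le_exp (ε * ‖l‖ ^ 2)
      have : 0 ≤ ε * ‖l‖ ^ 2 := by positivity
      nlinarith
    by_contra hxD
    have h4 : infDist (a + (z + l) • w) Dᶜ ≤ ‖x - (b - (b - (a + z • w))) - l • w‖ := by
      refine (infDist_le_dist_of_mem (show x ∈ Dᶜ from hxD)).trans_eq ?_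
      rw [dist_comm, dist_eq_norm]
      congr 1
      module
    have h5 : exp (-(g l).re + ε * ‖l‖ ^ 2) ^ 2 ≤
        ‖x - (b - (b - (a + z • w))) - l • w‖ ^ 2 := by
      gcongr; exact h1.trans h4
    linarith

open Real Metric Set Topology in
/-- The curve `l ↦ l w + f(l) v` is tangent at `l = 0` to the complex hyperplane orthogonal to
`v`, since the balls of radius `‖v‖ |f(l)|` around `l w` do not contain the point `v`. -/
theorem inner_add_deriv_smul_eq_zero {E : Type*} [NormedAddCommGroup E]
    [InnerProductSpace ℂ E] {v w : E} {f : ℂ → ℂ} (hf : Differentiable ℂ f) (hf0 : f 0 = 1)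
    {ρ : ℝ} (hρ : 0 < ρ) (h : ∀ l : ℂ, ‖l‖ ≤ ρ → ‖v‖ * ‖f l‖ ≤ ‖v - l • w‖) :
    inner ℂ v (w + deriv f 0 • v) = 0 := by
  set F : ℂ → ℂ := fun l => (‖v‖ ^ 2 : ℝ) * f l + l * inner ℂ v w with hF
  obtain ⟨c, hc⟩ : ∃ c : ℂ, c = (‖v‖ ^ 2 : ℝ) * deriv f 0 + inner ℂ v w := ⟨_, rfl⟩
  have hFd : HasDerivAt F c 0 := by
    have h1 := ((hf 0).hasDerivAt.const_mul ((‖v‖ ^ 2 : ℝ) : ℂ)).add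
      ((hasDerivAt_id (0 : ℂ)).mul_const (inner ℂ v w))
    rw [one_mul, ← hc] at h1
    exact h1
  have hFle : ∀ l : ℂ, ‖l‖ ≤ ρ → (F l).re - ‖l‖ ^ 2 * ‖w‖ ^ 2 / 2 ≤ ‖v‖ ^ 2 := by
    intro l hl
    have h1 : ‖v - l • w‖ ^ 2 = ‖v‖ ^ 2 - 2 * (l * inner ℂ v w).re + ‖l‖ ^ 2 * ‖w‖ ^ 2 := by
      rw [@norm_sub_sq ℂ, inner_smul_right, norm_smul, mul_pow]; rfl
    have h2 : ‖v‖ ^ 2 * (f l).re ≤ ‖v‖ * ‖v - l • w‖ := by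
      calc ‖v‖ ^ 2 * (f l).re ≤ ‖v‖ ^ 2 * ‖f l‖ := by gcongr; exact Complex.re_le_norm _
        _ = ‖v‖ * (‖v‖ * ‖f l‖) := by ring
        _ ≤ _ := by gcongr; exact h l hl
    have h3 : (F l).re = ‖v‖ ^ 2 * (f l).re + (l * inner ℂ v w).re := by
      simp only [hF, Complex.add_re]; rw [Complex.re_ofReal_mul]
    nlinarith [sq_nonneg (‖v‖ - ‖v - l • w‖)]
  -- Differentiate along the real line in the direction `conj c`.
  have hd : HasDerivAt (fun t : ℝ => (F (t * (starRingEnd ℂ) c)).re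
      - t ^ 2 * (‖c‖ ^ 2 * ‖w‖ ^ 2 / 2)) (c * (starRingEnd ℂ) c).re 0 := by
    have h1 : HasDerivAt (fun ζ : ℂ => F (ζ * (starRingEnd ℂ) c)) (c * (starRingEnd ℂ) c)
        ((0 : ℝ) : ℂ) := by
      have h2 : HasDerivAt (fun ζ : ℂ => ζ * (starRingEnd ℂ) c) ((starRingEnd ℂ) c)
          ((0 : ℝ) : ℂ) := by
        simpa using (hasDerivAt_id ((0 : ℝ) : ℂ)).mul_const ((starRingEnd ℂ) c)
      exact HasDerivAt.comp (h₂ := F) _ (by simpa using hFd) h2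
    have h3 := h1.real_of_complex.sub
      (((hasDerivAt_id (0 : ℝ)).pow 2).mul_const (‖c‖ ^ 2 * ‖w‖ ^ 2 / 2))
    refine h3.congr_deriv ?_
    simp
  have hmax : IsLocalMax (fun t : ℝ => (F (t * (starRingEnd ℂ) c)).re
      - t ^ 2 * (‖c‖ ^ 2 * ‖w‖ ^ 2 / 2)) 0 := by
    have hcont : Continuous fun t : ℝ => ‖(t : ℂ) * (starRingEnd ℂ) c‖ := by fun_prop
    have hev : ∀ᶠ t : ℝ in 𝓝 0, ‖(t : ℂ) * (starRingEnd ℂ) c‖ < ρ :=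
      hcont.continuousAt.eventually_lt continuousAt_const (by simpa using hρ)
    filter_upwards [hev] with t ht
    have h1 := hFle _ ht.le
    have h2 : ‖(t : ℂ) * (starRingEnd ℂ) c‖ ^ 2 = t ^ 2 * ‖c‖ ^ 2 := by
      rw [norm_mul, mul_pow, RCLike.norm_conj, Complex.norm_real, Real.norm_eq_abs, sq_abs]
    have h3 : (F (((0 : ℝ) : ℂ) * (starRingEnd ℂ) c)).re = ‖v‖ ^ 2 := by
      simp only [hF, hf0, Complex.ofReal_zero, zero_mul, mul_one, add_zero, Complex.ofReal_re]
    rw [h3]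
    rw [h2] at h1
    linarith
  have hc0 := hmax.hasDerivAt_eq_zero hd
  rw [Complex.mul_conj, Complex.ofReal_re, Complex.normSq_eq_zero] at hc0
  rw [hc] at hc0
  push_cast at hc0
  rw [inner_add_right, inner_smul_right, inner_self_eq_norm_sq_to_K, add_comm, mul_comm]
  exact hc0

/-! ### The continuity principle and sections that are not pseudoconvex -/

theorem IsContinuousPSH.comp_continuousLinearMap {E F : Type*} [NormedAddCommGroup E]
    [NormedSpace ℂ E] [NormedAddCommGroup F] [NormedSpace ℂ F] {u : F → ℝ} {D : Set F}
    (hu : IsContinuousPSH u D) (L : E →L[ℂ] F) :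
    IsContinuousPSH (fun x => u (L x)) (L ⁻¹' D) := by
  refine ⟨hu.1.comp L.continuous.continuousOn fun _ h => h, fun a b hab => ?_⟩
  simpa using hu.2 (L a) (L b) fun ζ hζ => by simpa using hab ζ hζ

open Real Metric Set Topology Filter in
/-- Continuity principle: an open set with a continuous plurisubharmonic exhaustion function
contains the limit `0` of the centres `-t f(0) e` of a family of holomorphic discs
`l ↦ l W + (s(l) - t f(l)) e`, `t > 0`, whose boundaries stay in a compact subset. -/
theorem IsPseudoconvex.zero_mem_of_discs {Q : Type*} [NormedAddCommGroup Q] [NormedSpace ℂ Q]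
    {G : Set Q} (hG : IsPseudoconvex G) {W e : Q} {s f : ℂ → ℂ} (hs : Differentiable ℂ s)
    (hf : Differentiable ℂ f) (hs0 : s 0 = 0) {r T : ℝ} (hr : 0 < r) (hT : 0 < T)
    (hmem : ∀ (t : ℝ) (l : ℂ), 0 ≤ t → t ≤ T → ‖l‖ ≤ r → (0 < t ∨ l ≠ 0) →
      l • W + (s l - t * f l) • e ∈ G) : (0 : Q) ∈ G := by
  obtain ⟨hGo, u, hu, hcomp⟩ := hG
  set Z : ℝ × ℂ → Q := fun p => p.2 • W + (s p.2 - p.1 * f p.2) • e with hZ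
  have hZc : Continuous Z := by
    have := hs.continuous
    have := hf.continuous
    fun_prop
  have hK : IsCompact (Icc (0 : ℝ) T ×ˢ sphere (0 : ℂ) r) :=
    isCompact_Icc.prod (isCompact_sphere _ _)
  have hKG : MapsTo Z (Icc (0 : ℝ) T ×ˢ sphere (0 : ℂ) r) G := by
    rintro ⟨t, l⟩ ⟨ht, hl⟩
    have hl' : ‖l‖ = r := by simpa using hl
    exact hmem t l ht.1 ht.2 hl'.le (Or.inr (norm_pos_iff.1 (hl' ▸ hr)))
  obtain ⟨M, hM⟩ := (hK.image_of_continuousOn (hu.1.comp hZc.continuousOn hKG)).bddAbove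
  set L : ℂ × ℂ →L[ℂ] Q := (ContinuousLinearMap.fst ℂ ℂ ℂ).smulRight W +
    (ContinuousLinearMap.snd ℂ ℂ ℂ).smulRight e with hL
  have hLapp : ∀ p : ℂ × ℂ, L p = p.1 • W + p.2 • e := fun p => by simp [hL]
  have hcen : ∀ t : ℝ, 0 < t → t ≤ T → Z (t, 0) ∈ {z | z ∈ G ∧ u z ≤ M} := by
    intro t ht htT
    refine ⟨hmem t 0 ht.le htT (by simpa using hr.le) (Or.inl ht), ?_⟩
    have h := (hu.comp_continuousLinearMap L).le_of_graph (hGo.preimage L.continuous)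
      (s := fun l => s l - t * f l) (by fun_prop) hr (M := M) (fun l hl => ?_) fun l hl => ?_
    · simpa only [hLapp] using h
    · simpa only [mem_preimage, hLapp] using hmem t l ht.le htT hl (Or.inl ht)
    · rw [hLapp]
      exact hM ⟨(t, l), ⟨⟨ht.le, htT⟩, by simpa using hl⟩, rfl⟩
  have hlim : Tendsto (fun t : ℝ => Z (t, 0)) (𝓝[>] 0) (𝓝 0) := by
    refine (Continuous.tendsto' (by fun_prop) 0 0 ?_).mono_left nhdsWithin_le_nhds
    simp [hZ, hs0]
  refine ((hcomp M).isClosed.mem_of_tendsto hlim ?_).1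
  filter_upwards [Ioc_mem_nhdsGT hT] with t ht
  exact hcen t ht.1 ht.2

open Real Metric Set Topology Filter in
/-- Let `D` contain the family of balls of `exists_touching_family_of_balls` at `b`. Every linear
section of `D` through `b` whose direction contains the tangent vector `w + f'(0) v` and a vector
`e` transverse to `vᗮ` fails to be pseudoconvex: projecting the curve `l w + (f(l) - 1) v` to
the section along `vᗮ` moves it by `o(|l|)` only, orthogonally to `v`, so the projected disc
and its translates into `D` still lie in the union of the balls. -/
theorem not_isPseudoconvex_section {E : Type*} [NormedAddCommGroup E]
    [InnerProductSpace ℂ E] {D : Set E} {b v w e : E} {f : ℂ → ℂ} {ε ρ : ℝ} (hε : 0 < ε)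
    (hρ : 0 < ρ) (hb : b ∉ D) (hv : v ≠ 0) (hf : Differentiable ℂ f) (hf0 : f 0 = 1)
    (hD : ∀ (l : ℂ) (x : E), ‖l‖ ≤ ρ →
        ‖x - (b - v) - l • w‖ ^ 2 < ‖v‖ ^ 2 * ‖f l‖ ^ 2 * (1 + ε * ‖l‖ ^ 2) → x ∈ D)
    (he : inner ℂ v (e - v) = 0) (Q : Submodule ℂ E) (hWQ : w + deriv f 0 • v ∈ Q)
    (heQ : e ∈ Q) : ¬ IsPseudoconvex {x : Q | b + (x : E) ∈ D} := by
  intro hG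
  set V : ℝ := ‖v‖ ^ 2 with hV
  set N : ℝ := ‖e - v‖ ^ 2 with hN
  have hV0 : 0 < V := by positivity
  have hN0 : 0 ≤ N := by positivity
  set k : ℂ → ℂ := fun l => f l - 1 - l * deriv f 0 with hk
  obtain ⟨r, hr, hrρ, hfr, hkr⟩ : ∃ r > 0, r ≤ ρ ∧ (∀ l : ℂ, ‖l‖ ≤ r → 1 / 2 ≤ ‖f l‖) ∧
      ∀ l : ℂ, ‖l‖ ≤ r → 2 * ‖k l‖ ^ 2 * N ≤ ε / 8 * ‖l‖ ^ 2 * V := by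
    have h1 : ∀ᶠ l in 𝓝 (0 : ℂ), 1 / 2 < ‖f l‖ :=
      continuousAt_const.eventually_lt hf.continuous.norm.continuousAt (by norm_num [hf0])
    have h2 := ((hf 0).hasDerivAt.isLittleO).def (c := √(ε * V / (16 * (N + 1)))) (by positivity)
    obtain ⟨r, hr, hrs⟩ := Metric.nhds_basis_closedBall.eventually_iff.1 (h1.and h2)
    refine ⟨min r ρ, lt_min hr hρ, min_le_right _ _, fun l hl => ?_, fun l hl => ?_⟩
    · exact (hrs (by simpa using hl.trans (min_le_left _ _))).1.le
    · have h3 := (hrs (show l ∈ closedBall (0 : ℂ) r by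
        simpa using hl.trans (min_le_left _ _))).2
      have h4 : ‖k l‖ ≤ √(ε * V / (16 * (N + 1))) * ‖l‖ := by simpa [hk, hf0] using h3
      calc 2 * ‖k l‖ ^ 2 * N ≤ 2 * (√(ε * V / (16 * (N + 1))) * ‖l‖) ^ 2 * (N + 1) := by
            gcongr; linarith
        _ = ε / 8 * ‖l‖ ^ 2 * V := by
            rw [mul_pow, Real.sq_sqrt (by positivity)]; field_simp; ring
  have hkd : Differentiable ℂ k := by fun_prop
  refine hb ?_
  have h0 := hG.zero_mem_of_discs (W := ⟨_, hWQ⟩) (e := ⟨e, heQ⟩) hkd hf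
    (by simp [hk, hf0]) hr (T := V / (V + 2 * N)) (by positivity) ?_
  · simpa using h0
  intro t l ht htT hl htl
  have htT' : t * (V + 2 * N) ≤ V := (le_div_iff₀ (by positivity)).1 htT
  refine hD l _ (hl.trans hrρ) ?_
  have hx : b + ((l • (⟨_, hWQ⟩ : Q) + (k l - t * f l) • (⟨e, heQ⟩ : Q) : Q) : E)
      - (b - v) - l • w = ((1 - t) * f l) • v + (k l - t * f l) • (e - v) := by
    simp only [Submodule.coe_add, Submodule.coe_smul, hk]
    module
  have hnorm : ‖((1 - t) * f l) • v + (k l - t * f l) • (e - v)‖ ^ 2 =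
      (1 - t) ^ 2 * ‖f l‖ ^ 2 * V + ‖k l - t * f l‖ ^ 2 * N := by
    have ho : inner ℂ (((1 - t) * f l) • v) ((k l - t * f l) • (e - v)) = 0 := by
      rw [inner_smul_left, inner_smul_right, he]; simp
    have h1 : ‖(1 - t : ℂ)‖ ^ 2 = (1 - t) ^ 2 := by
      rw [show (1 - t : ℂ) = ((1 - t : ℝ) : ℂ) by push_cast; ring, Complex.norm_real,
        Real.norm_eq_abs, sq_abs]
    rw [@norm_add_sq ℂ, ho, norm_smul, norm_smul, norm_mul]
    simp only [map_zero, mul_zero, add_zero, mul_pow, h1, hV, hN]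
  rw [hx, hnorm]
  have hF : (1 / 4 : ℝ) ≤ ‖f l‖ ^ 2 := by nlinarith [hfr l hl]
  have hkt : ‖k l - t * f l‖ ^ 2 ≤ 2 * ‖k l‖ ^ 2 + 2 * t ^ 2 * ‖f l‖ ^ 2 := by
    have h1 : ‖k l - t * f l‖ ≤ ‖k l‖ + t * ‖f l‖ := by
      refine (norm_sub_le _ _).trans_eq ?_
      rw [norm_mul, Complex.norm_real, Real.norm_eq_abs, abs_of_nonneg ht]
    calc _ ≤ (‖k l‖ + t * ‖f l‖) ^ 2 := by gcongr
      _ ≤ _ := by nlinarith [sq_nonneg (‖k l‖ - t * ‖f l‖)]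
  have hk1 := hkr l hl
  have hL : 0 < t + ε * ‖l‖ ^ 2 := by
    rcases htl with h | h
    · positivity
    · have := norm_pos_iff.2 h
      positivity
  generalize ‖f l‖ ^ 2 = F at *
  generalize ‖l‖ ^ 2 = R at *
  have hR : 0 ≤ ε * R * V := by nlinarith [hkr 0]
  have h2 : 2 * ‖k l‖ ^ 2 * N ≤ ε / 2 * R * V * F := by nlinarith
  have h3 : t * (t * (V + 2 * N)) * F ≤ t * V * F := by gcongr
  have h4 : ‖k l - t * f l‖ ^ 2 * N ≤ (2 * ‖k l‖ ^ 2 + 2 * t ^ 2 * F) * N := by gcongr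
  have h5 : 0 < (t + ε / 2 * R) * V * F := by
    have : 0 < t + ε / 2 * R := by linarith
    positivity
  nlinarith

/-! ### Exceptional points -/

theorem isPseudoconvex_empty {E : Type*} [NormedAddCommGroup E] [NormedSpace ℂ E] :
    IsPseudoconvex (∅ : Set E) := by
  refine ⟨isOpen_empty, fun _ => 0, ⟨continuousOn_empty _, fun a b h => ?_⟩, fun c => by simp⟩
  exact absurd (h 0 (by simp)) (Set.notMem_empty _)

theorem isExceptional_iff_notMem {n : ℕ} (D : Set (EuclideanSpace ℂ (Fin n)))
    (a : EuclideanSpace ℂ (Fin n)) :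
    IsExceptional D a ↔ a ∉ nonPseudoconvexPlanesUnion D := by
  constructor
  · rintro h ⟨P, hP, -, hPD, ha⟩
    exact hPD (h P hP ha)
  · intro h P hP ha
    by_contra hPD
    refine h ⟨P, hP, ?_, hPD, ha⟩
    by_contra hne
    refine hPD fun p hp => ?_
    have hempty : {v : P.direction | p + (v : EuclideanSpace ℂ (Fin n)) ∈ D} = ∅ := by
      refine Set.eq_empty_of_forall_notMem fun v hv => hne ⟨p + v, ?_, hv⟩
      simpa [add_comm] using AffineSubspace.vadd_mem_of_mem_direction v.2 hp
    rw [hempty]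
    exact isPseudoconvex_empty

theorem mainTheorem6 (n : ℕ) (hn : 3 ≤ n) (D : Set (EuclideanSpace ℂ (Fin n)))
    (hD : IsOpen D) (hDpc : ¬ IsPseudoconvex D) :
    {a | IsExceptional D a} = (nonPseudoconvexPlanesUnion D)ᶜ ∧
      ∃ T : AffineSubspace ℂ (EuclideanSpace ℂ (Fin n)), IsComplexHyperplane T ∧
        (nonPseudoconvexPlanesUnion D)ᶜ ⊆ (T : Set (EuclideanSpace ℂ (Fin n))) := by
  refine ⟨Set.ext fun a => isExceptional_iff_notMem D a, ?_⟩
  obtain ⟨b, v, w, f, ε, hε, ρ, hρ, hb, hv, hf, hf0, hballs⟩ :=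
    exists_touching_family_of_balls hD hDpc
  have hW : inner ℂ v (w + deriv f 0 • v) = 0 := by
    refine inner_add_deriv_smul_eq_zero hf hf0 hρ fun l hl => ?_
    by_contra! h
    refine hb (hballs l b hl ?_)
    rw [sub_sub_cancel]
    calc ‖v - l • w‖ ^ 2 < (‖v‖ * ‖f l‖) ^ 2 := by gcongr
      _ = ‖v‖ ^ 2 * ‖f l‖ ^ 2 * 1 := by ring
      _ ≤ ‖v‖ ^ 2 * ‖f l‖ ^ 2 * (1 + ε * ‖l‖ ^ 2) := by
        gcongr
        have : 0 ≤ ε * ‖l‖ ^ 2 := by positivity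
        linarith
  have hrank : finrank ℂ (ℂ ∙ v)ᗮ + 1 = n := by
    have h := Submodule.finrank_add_finrank_orthogonal (ℂ ∙ v)
    rw [finrank_span_singleton hv, finrank_euclideanSpace_fin] at h
    omega
  refine ⟨AffineSubspace.mk' b (ℂ ∙ v)ᗮ, ⟨⟨b, AffineSubspace.self_mem_mk' _ _⟩, ?_⟩,
    fun c hc => ?_⟩
  · rwa [AffineSubspace.direction_mk']
  rw [SetLike.mem_coe, AffineSubspace.mem_mk', vsub_eq_sub,
    Submodule.mem_orthogonal_singleton_iff_inner_right]
  by_contra hcb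
  -- A nonzero vector orthogonal to `v` whose span contains the tangent vector of the curve.
  obtain ⟨W, hW0, hvW, hWspan⟩ : ∃ W, W ≠ 0 ∧ inner ℂ v W = 0 ∧
      w + deriv f 0 • v ∈ (ℂ ∙ W) := by
    by_cases h0 : w + deriv f 0 • v = 0
    · have : Nontrivial (ℂ ∙ v)ᗮ := nontrivial_of_finrank_pos (R := ℂ) (by omega)
      obtain ⟨⟨W, hWo⟩, hW0⟩ := exists_ne (0 : (ℂ ∙ v)ᗮ)
      refine ⟨W, fun h => hW0 (Subtype.ext h), ?_, by simp [h0]⟩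
      exact Submodule.mem_orthogonal_singleton_iff_inner_right.1 hWo
    · exact ⟨_, h0, hW, Submodule.mem_span_singleton_self _⟩
  -- Scale `c - b` so that its component along `v` is `v` itself.
  set e := (inner ℂ v v / inner ℂ v (c - b)) • (c - b) with he
  have hve : inner ℂ v e = inner ℂ v v := by
    rw [he, inner_smul_right, div_mul_cancel₀ _ hcb]
  have hvv : inner ℂ v v ≠ 0 := inner_self_ne_zero.2 hv
  have hli : LinearIndependent ℂ ![W, c - b] := by
    rw [LinearIndependent.pair_iff' hW0]
    intro a ha
    rw [← ha, inner_smul_right, hvW, mul_zero] at hcb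
    exact hcb rfl
  set P := AffineSubspace.mk' b (Submodule.span ℂ (Set.range ![W, c - b])) with hP
  have hPdir : P.direction = Submodule.span ℂ (Set.range ![W, c - b]) :=
    AffineSubspace.direction_mk' _ _
  have hbP : b ∈ P := AffineSubspace.self_mem_mk' _ _
  have hPplane : IsComplexPlane P := by
    refine ⟨⟨b, hbP⟩, ?_⟩
    rw [hPdir, finrank_span_eq_card hli, Fintype.card_fin]
  have hWP : W ∈ P.direction := hPdir ▸ Submodule.subset_span ⟨0, rfl⟩
  have hcbP : c - b ∈ P.direction := hPdir ▸ Submodule.subset_span ⟨1, rfl⟩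
  have hcP : c ∈ P := by
    simpa using AffineSubspace.vadd_mem_of_mem_direction hcbP hbP
  refine not_isPseudoconvex_section hε hρ hb hv hf hf0 hballs (e := e) ?_ P.direction
    ((Submodule.span_singleton_le_iff_mem _ _).2 hWP hWspan) (P.direction.smul_mem _ hcbP)
    ((isExceptional_iff_notMem D c).2 hc P hPplane hcP b hbP)
  rw [inner_sub_right, hve, sub_self]
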